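/- Let $0<\gamma\le 2$, $\alpha=(4-3\gamma)/\sqrt6$ and $k\in\{0,-1\}$. Let $V\in C^2(\mathbb R)$ be such that $\{V<0\}$ is bounded and $V$ has finitely many critical points. A cosmology on a time interval consists of real functions $a>0$, $\phi$, $y=\dot\phi$, $\rho$ and $H=\dot a/a$ of $t$ with $$H^2+\frac{k}{a^2}=\frac13\Bigl(\rho+\frac12y^2+V(\phi)\Bigr),\qquad \dot H=-\frac12y^2-\frac\gamma2\rho+\frac{k}{a^2},$$ $$\dot y=-3Hy-V'(\phi)+\alpha\rho,\qquad \dot\rho=-3\gamma\rho H-\alpha\rho y .$$ Admissible initial states are the $(\phi_0,y_0,\rho_0,H_0)$ with $\rho_0\ge0$, $H_0>0$ which satisfy the first equation for some $a_0>0$. For $\ell\ge0$, neighbourhoods of the configuration at infinity $(\phi=+\infty,\,y=0,\,\rho=0,\,H=\sqrt{\ell/3})$ are the sets that contain $\{\phi>M,\ |y|<\delta,\ |\rho|<\delta,\ |H-\sqrt{\ell/3}|<\delta\}$ for some $M\in\mathbb R$, $\delta>0$. (i) If $V(\phi)\to\ell$ as $\phi\to+\infty$ with $V(\phi)>\ell$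 for all large $\phi$, then the configuration at infinity is asymptotically stable: for every neighbourhood $U$ of it there is a neighbourhood $U'$ such that the cosmologies with admissible initial state in $U'$ exist for all $t\ge0$ and remain in $U$; and there is a neighbourhood $U_0$ such that the cosmologies with admissible initial state in $U_0$ exist for all $t\ge0$ and satisfy $\phi\to+\infty$, $y\to0$, $\rho\to0$, $H\to\sqrt{\ell/3}$ as $t\to+\infty$. In particular this holds, with $\ell=0$, for $V(\phi)=V_0e^{-\lambda\phi}$ with $V_0,\lambda>0$. (ii) If $V(\phi)\to\ell$ as $\phi\to+\infty$ with $V(\phi)<\ell$ for all large $\phi$, then the configuration at infinity is unstable: there is a neighbourhood $U$ of it such that every neighbourhood of it contains an admissible initial state from which the cosmology leaves $U$ in finite time, and does not converge to the configuration at infinity as $t\to+\infty$. -/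

import Mathlib

open Filter Topology

/-- Standing assumption on the potential: `V` is of class `C²` on `ℝ`, the set where `V` is negative
is bounded, and `V` has finitely many critical points (both sets may be empty). -/
structure IsAdmissiblePotential (V : ℝ → ℝ) : Prop where
  contDiff : ContDiff ℝ 2 V
  bounded_neg : Bornology.IsBounded {x : ℝ | V x < 0}
  finite_crit : {x : ℝ | deriv V x = 0}.Finite

/-- The coupling constant `α = (4 - 3γ)/√6`. -/
noncomputable def coupling (γ : ℝ) : ℝ := (4 - 3 * γ) / √6

/-- The FRW cosmology of spatial curvature `k` with a scalar field `φ` (potential `V`) coupled to a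
barotropic fluid of density `ρ` and pressure `(γ - 1) ρ`, on the time interval `s`.
Here `a` is the scale factor, `H = a'/a` is the Hubble function and `y = φ'`.
The equations are the Friedmann constraint, the Raychaudhuri equation, the equation of motion of the
scalar field and the conservation equation; derivatives are taken within `s`
(so they are one-sided at an end point of `s`). -/
structure IsCosmology (V : ℝ → ℝ) (γ k : ℝ) (s : Set ℝ) (a φ y ρ H : ℝ → ℝ) : Prop where
  scale_pos : ∀ t ∈ s, 0 < a t
  hubble : ∀ t ∈ s, HasDerivWithinAt a (a t * H t) s t
  velocity : ∀ t ∈ s, HasDerivWithinAt φ (y t) s t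
  motion : ∀ t ∈ s, HasDerivWithinAt y
    (-3 * H t * y t - deriv V (φ t) + coupling γ * ρ t) s t
  conservation : ∀ t ∈ s, HasDerivWithinAt ρ
    (-3 * γ * ρ t * H t - coupling γ * ρ t * y t) s t
  raychaudhuri : ∀ t ∈ s, HasDerivWithinAt H
    (-(1 / 2) * y t ^ 2 - γ / 2 * ρ t + k / a t ^ 2) s t
  friedmann : ∀ t ∈ s,
    H t ^ 2 + k / a t ^ 2 = 1 / 3 * (ρ t + 1 / 2 * y t ^ 2 + V (φ t))

/-- The initial states `(φ, y, ρ, H)` of expanding cosmologies of curvature `k`: nonnegative fluid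
density, `H > 0`, and the Friedmann constraint for some value `a > 0` of the scale factor. -/
def expandingStates (V : ℝ → ℝ) (k : ℝ) : Set (ℝ × ℝ × ℝ × ℝ) :=
  {p | 0 ≤ p.2.2.1 ∧ 0 < p.2.2.2 ∧ ∃ a : ℝ, 0 < a ∧
    p.2.2.2 ^ 2 + k / a ^ 2 = 1 / 3 * (p.2.2.1 + 1 / 2 * p.2.1 ^ 2 + V p.1)}

/-- The filter of neighbourhoods of the configuration at infinity
`(φ = +∞, y = 0, ρ = 0, H = √(ℓ/3))`; it is generated by the sets
`φ > M, |y| < δ, |ρ| < δ, |H - √(ℓ/3)| < δ`. -/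
noncomputable def nhdsAtInfinity (ℓ : ℝ) : Filter (ℝ × ℝ × ℝ × ℝ) :=
  atTop ×ˢ 𝓝 0 ×ˢ 𝓝 0 ×ˢ 𝓝 √(ℓ / 3)

/-- The state `(φ, y, ρ, H)` equals `p` at time `0`. -/
def StartsAt (p : ℝ × ℝ × ℝ × ℝ) (φ y ρ H : ℝ → ℝ) : Prop :=
  (φ 0, y 0, ρ 0, H 0) = p

/-- `φ → +∞`, `y → 0`, `ρ → 0` and `H → √(ℓ/3)` as `t → +∞`. -/
def ConvergesToInfinity (ℓ : ℝ) (φ y ρ H : ℝ → ℝ) : Prop :=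
  Tendsto φ atTop atTop ∧ Tendsto y atTop (𝓝 0) ∧ Tendsto ρ atTop (𝓝 0) ∧
    Tendsto H atTop (𝓝 √(ℓ / 3))

/-- Some cosmology that exists for all times `t ≥ 0` starts at `p`. -/
def ExistsGlobally (V : ℝ → ℝ) (γ k : ℝ) (p : ℝ × ℝ × ℝ × ℝ) : Prop :=
  ∃ a φ y ρ H : ℝ → ℝ, IsCosmology V γ k (Set.Ici 0) a φ y ρ H ∧ StartsAt p φ y ρ H

/-- Lyapunov stability of the configuration at infinity for expanding cosmologies of curvature `k`:
given a neighbourhood `U` of it, the cosmologies that start sufficiently close to it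
exist for all times `t ≥ 0` and never leave `U`. -/
def IsStableAtInfinity (V : ℝ → ℝ) (γ k ℓ : ℝ) : Prop :=
  ∀ U ∈ nhdsAtInfinity ℓ, ∀ᶠ p in nhdsAtInfinity ℓ ⊓ 𝓟 (expandingStates V k),
    ExistsGlobally V γ k p ∧
    ∀ a φ y ρ H : ℝ → ℝ, IsCosmology V γ k (Set.Ici 0) a φ y ρ H → StartsAt p φ y ρ H →
      ∀ t, 0 ≤ t → (φ t, y t, ρ t, H t) ∈ U

/-- The configuration at infinity attracts the expanding cosmologies of curvature `k` that start
sufficiently close to it. -/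
def IsAttractiveAtInfinity (V : ℝ → ℝ) (γ k ℓ : ℝ) : Prop :=
  ∀ᶠ p in nhdsAtInfinity ℓ ⊓ 𝓟 (expandingStates V k),
    ExistsGlobally V γ k p ∧
    ∀ a φ y ρ H : ℝ → ℝ, IsCosmology V γ k (Set.Ici 0) a φ y ρ H → StartsAt p φ y ρ H →
      ConvergesToInfinity ℓ φ y ρ H

/-- Asymptotic stability: Lyapunov stability together with attractivity. -/
def IsAsymptoticallyStableAtInfinity (V : ℝ → ℝ) (γ k ℓ : ℝ) : Prop :=
  IsStableAtInfinity V γ k ℓ ∧ IsAttractiveAtInfinity V γ k ℓ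

/-- Instability of the configuration at infinity: there is a neighbourhood `U` of it such that,
arbitrarily close to it, there are initial states of expanding cosmologies of curvature `k` from
which the cosmology leaves `U` in finite time, and does not converge to the configuration either. -/
def IsUnstableAtInfinity (V : ℝ → ℝ) (γ k ℓ : ℝ) : Prop :=
  ∃ U ∈ nhdsAtInfinity ℓ, ∃ᶠ p in nhdsAtInfinity ℓ ⊓ 𝓟 (expandingStates V k),
    (∃ T : ℝ, 0 < T ∧ ∃ a φ y ρ H : ℝ → ℝ, IsCosmology V γ k (Set.Icc 0 T) a φ y ρ H ∧
      StartsAt p φ y ρ H ∧ (φ T, y T, ρ T, H T) ∉ U) ∧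
    ∀ a φ y ρ H : ℝ → ℝ, IsCosmology V γ k (Set.Ici 0) a φ y ρ H → StartsAt p φ y ρ H →
      ¬ ConvergesToInfinity ℓ φ y ρ H

/-!
Along an expanding cosmology of curvature `k ≤ 0` with fluid density `ρ ≥ 0`, both `H` and the
energy `E = ρ + y²/2 + V(φ)` decrease, `E' = -3 H (y² + γ ρ)`, and `E ≤ 3 H²`.

If `V` decreases to `ℓ`, an energy below `V M` keeps `φ` beyond `M`, which gives global existence
and stability. If `E` stayed above `ℓ + ε`, then `H` would be bounded below and, since the friction
terms in `y' = -3 H y - V' + α ρ` are dominated by a small constant plus a multiple of `y² + γ ρ`,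
the bounded quantity `y - K E` would grow linearly for large `K`. So `E → ℓ`, and then
`V(φ) → ℓ`, that is `φ → ∞`, while `y, ρ → 0` and `H² = E/3 - k/a² → ℓ/3`.

If `V` increases to `ℓ`, start at rest at a large `x`, without fluid and with `a² = 3/(ℓ - V x)`.
The energy `V x` is less than `ℓ` and decreases, so the limit state is not reached and `φ ≤ x`.
There `V'` is bounded below, and the same argument applied to `-y - K E` forces `φ` or `H` to leave
a fixed neighbourhood.
-/

section Calculus

section NormedSpace

variable {E : Type*} [NormedAddCommGroup E] [NormedSpace ℝ E] {f f' : ℝ → E}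

theorem eq_of_forall_hasDerivWithinAt_zero {s : Set ℝ} {a b : ℝ} (hs : Convex ℝ s)
    (hf : ∀ t ∈ s, HasDerivWithinAt f 0 s t) (ha : a ∈ s) (hb : b ∈ s) : f a = f b := by
  have h := hs.norm_image_sub_le_of_norm_hasDerivWithin_le hf (fun _ _ => norm_zero.le) hb ha
  rwa [zero_mul, norm_le_zero_iff, sub_eq_zero] at h

theorem norm_le_norm_add_mul_of_norm_hasDerivWithinAt_le {a b c : ℝ} (hab : a ≤ b)
    (hf : ∀ t ∈ Set.Icc a b, HasDerivWithinAt f (f' t) (Set.Icc a b) t)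
    (hf' : ∀ t ∈ Set.Icc a b, ‖f' t‖ ≤ c) : ‖f b‖ ≤ ‖f a‖ + c * (b - a) := by
  have h := (convex_Icc a b).norm_image_sub_le_of_norm_hasDerivWithin_le hf hf'
    (Set.left_mem_Icc.2 hab) (Set.right_mem_Icc.2 hab)
  rw [Real.norm_of_nonneg (sub_nonneg.2 hab)] at h
  linarith [norm_sub_norm_le (f b) (f a)]

end NormedSpace

section Real

variable {f f' : ℝ → ℝ} {s : Set ℝ} {a δ : ℝ}

theorem monotoneOn_of_forall_hasDerivWithinAt_nonneg (hs : Convex ℝ s)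
    (hf : ∀ t ∈ s, HasDerivWithinAt f (f' t) s t) (hf' : ∀ t ∈ s, 0 ≤ f' t) : MonotoneOn f s :=
  monotoneOn_of_hasDerivWithinAt_nonneg hs (HasDerivWithinAt.continuousOn hf)
    (fun t ht => (hf t (interior_subset ht)).mono interior_subset)
    (fun t ht => hf' t (interior_subset ht))

theorem antitoneOn_of_forall_hasDerivWithinAt_nonpos (hs : Convex ℝ s)
    (hf : ∀ t ∈ s, HasDerivWithinAt f (f' t) s t) (hf' : ∀ t ∈ s, f' t ≤ 0) : AntitoneOn f s :=
  antitoneOn_of_hasDerivWithinAt_nonpos hs (HasDerivWithinAt.continuousOn hf)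
    (fun t ht => (hf t (interior_subset ht)).mono interior_subset)
    (fun t ht => hf' t (interior_subset ht))

theorem tendsto_atTop_of_le_hasDerivWithinAt (hδ : 0 < δ)
    (hf : ∀ t ∈ Set.Ici a, HasDerivWithinAt f (f' t) (Set.Ici a) t)
    (hf' : ∀ t ∈ Set.Ici a, δ ≤ f' t) : Tendsto f atTop atTop := by
  have hmono : MonotoneOn (fun t => f t - δ * t) (Set.Ici a) :=
    monotoneOn_of_forall_hasDerivWithinAt_nonneg (f' := fun t => f' t - δ * 1) (convex_Ici a)
      (fun t ht => (hf t ht).sub ((hasDerivWithinAt_id t _).const_mul δ))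
      (fun t ht => by linarith [hf' t ht])
  refine tendsto_atTop_mono' atTop ?_
    (tendsto_atTop_add_const_left atTop (f a - δ * a) (tendsto_id.const_mul_atTop hδ))
  filter_upwards [eventually_ge_atTop a] with t ht
  have h := hmono Set.self_mem_Ici ht ht
  simp only [id_eq] at h ⊢
  linarith

end Real

theorem exists_eq_and_forall_lt_of_continuousOn {α β : Type*} [ConditionallyCompleteLinearOrder α]
    [DenselyOrdered α] [TopologicalSpace α] [OrderTopology α] [LinearOrder β] [TopologicalSpace β]
    [OrderClosedTopology β] {f : α → β} {a b : α} {c : β} (hf : ContinuousOn f (Set.Icc a b))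
    (ha : f a < c) (hc : ∃ t ∈ Set.Icc a b, c ≤ f t) :
    ∃ τ ∈ Set.Ioc a b, f τ = c ∧ ∀ t ∈ Set.Ico a τ, f t < c := by
  have hcompact : IsCompact (Set.Icc a b ∩ f ⁻¹' Set.Ici c) :=
    isCompact_Icc.of_isClosed_subset (hf.preimage_isClosed_of_isClosed isClosed_Icc isClosed_Ici)
      Set.inter_subset_left
  obtain ⟨τ, ⟨⟨haτ, hτb⟩, hcτ⟩, hleast⟩ := hcompact.exists_isLeast hc
  have hlt : ∀ t ∈ Set.Ico a τ, f t < c := fun t ht =>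
    not_le.1 fun hct => ht.2.not_ge (hleast ⟨⟨ht.1, ht.2.le.trans hτb⟩, hct⟩)
  obtain ⟨t, ht, rfl⟩ := intermediate_value_Icc haτ (hf.mono (Set.Icc_subset_Icc_right hτb))
    ⟨ha.le, hcτ⟩
  obtain rfl : t = τ := le_antisymm ht.2 (hleast ⟨⟨ht.1, ht.2.trans hτb⟩, le_refl (f t)⟩)
  exact ⟨t, ⟨haτ.lt_of_ne fun h => ha.ne (congrArg f h), hτb⟩, rfl, hlt⟩

end Calculus

section ODE

variable {E : Type*} [NormedAddCommGroup E] [NormedSpace ℝ E] {F : E → E}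

theorem eqOn_Icc_of_isIntegralCurveOn {u v : ℝ → E} {a b : ℝ} (hF : LocallyLipschitz F)
    (hu : IsIntegralCurveOn u (fun _ => F) (Set.Icc a b))
    (hv : IsIntegralCurveOn v (fun _ => F) (Set.Icc a b)) (huv : u a = v a) :
    Set.EqOn u v (Set.Icc a b) := by
  obtain ⟨K, hK⟩ := hF.locallyLipschitzOn.exists_lipschitzOnWith_of_compact
    ((isCompact_Icc.image_of_continuousOn hu.continuousOn).union
      (isCompact_Icc.image_of_continuousOn hv.continuousOn))
  have toRight : ∀ {w : ℝ → E}, IsIntegralCurveOn w (fun _ => F) (Set.Icc a b) →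
      ∀ t ∈ Set.Ico a b, HasDerivWithinAt w (F (w t)) (Set.Ici t) t := fun hw t ht =>
    (hw t (Set.Ico_subset_Icc_self ht)).mono_of_mem_nhdsWithin (Icc_mem_nhdsGE_of_mem ht)
  exact ODE_solution_unique_of_mem_Icc_right (fun _ _ => hK) hu.continuousOn (toRight hu)
    (fun t ht => Or.inl ⟨t, Set.Ico_subset_Icc_self ht, rfl⟩) hv.continuousOn (toRight hv)
    (fun t ht => Or.inr ⟨t, Set.Ico_subset_Icc_self ht, rfl⟩) huv

theorem exists_isIntegralCurveOn_Ici_of_forall_Icc {u₀ : E} (hF : LocallyLipschitz F)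
    (h : ∀ T : ℝ, 0 < T → ∃ u, u 0 = u₀ ∧ IsIntegralCurveOn u (fun _ => F) (Set.Icc 0 T)) :
    ∃ u, u 0 = u₀ ∧ IsIntegralCurveOn u (fun _ => F) (Set.Ici 0) := by
  choose! u hu₀ hu using h
  have agree : ∀ S T t : ℝ, 0 < S → 0 < T → t ∈ Set.Icc 0 S → t ∈ Set.Icc 0 T → u S t = u T t :=
    fun S T t hS hT htS htT => eqOn_Icc_of_isIntegralCurveOn hF
      ((hu S hS).mono (Set.Icc_subset_Icc_right htS.2))
      ((hu T hT).mono (Set.Icc_subset_Icc_right htT.2)) ((hu₀ S hS).trans (hu₀ T hT).symm)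
      (Set.right_mem_Icc.2 htS.1)
  refine ⟨fun t => u (t + 1) t, hu₀ _ (by norm_num), fun t (ht : 0 ≤ t) => ?_⟩
  have hnhds : Set.Icc 0 (t + 1) ∈ 𝓝[Set.Ici 0] t := by
    filter_upwards [self_mem_nhdsWithin, nhdsWithin_le_nhds (Iio_mem_nhds (lt_add_one t))]
      with r hr hrt using ⟨hr, le_of_lt hrt⟩
  refine ((hu (t + 1) (by positivity) t ⟨ht, by linarith⟩).mono_of_mem_nhdsWithin
    hnhds).congr_of_eventuallyEq ?_ rfl
  filter_upwards [hnhds] with r hr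
  exact agree (r + 1) (t + 1) r (by linarith [hr.1]) (by positivity) ⟨hr.1, by linarith⟩ hr

variable [FiniteDimensional ℝ E]

theorem exists_lipschitzWith_bounded_eqOn_closedBall (hF : ContDiff ℝ 1 F) {R : ℝ} (hR : 0 < R) :
    ∃ (G : E → E) (K L : NNReal), LipschitzWith K G ∧ (∀ x, ‖G x‖ ≤ L) ∧
      Set.EqOn G F (Metric.closedBall 0 R) := by
  let χ : ContDiffBump (0 : E) := ⟨R, R + 1, hR, lt_add_one R⟩
  have hG : ContDiff ℝ 1 (fun x => χ x • F x) := χ.contDiff.smul hF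
  have hcompact : HasCompactSupport (fun x => χ x • F x) := χ.hasCompactSupport.smul_right
  obtain ⟨K, hK⟩ := ContDiff.lipschitzWith_of_hasCompactSupport hcompact hG one_ne_zero
  obtain ⟨L, hL⟩ := hcompact.exists_bound_of_continuous hG.continuous
  refine ⟨_, K, L.toNNReal, hK, fun x => (hL x).trans (Real.le_coe_toNNReal L), fun x hx => ?_⟩
  simp only [χ.one_of_mem_closedBall hx, one_smul]

theorem exists_isIntegralCurveOn_Icc_of_lipschitzWith {G : E → E} {K L : NNReal}
    (hK : LipschitzWith K G) (hL : ∀ x, ‖G x‖ ≤ L) (u₀ : E) {T : ℝ} (hT : 0 ≤ T) :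
    ∃ u, u 0 = u₀ ∧ IsIntegralCurveOn u (fun _ => G) (Set.Icc 0 T) := by
  have hPicard : IsPicardLindelof (fun _ => G) (⟨0, le_rfl, hT⟩ : Set.Icc 0 T) u₀
      (L * T.toNNReal) 0 L K :=
    IsPicardLindelof.of_time_independent (fun x _ => hL x) hK.lipschitzOnWith (by simp [hT])
  exact hPicard.exists_eq_forall_mem_Icc_hasDerivWithinAt₀

theorem exists_isIntegralCurveOn_Icc_or_norm_eq (hF : ContDiff ℝ 1 F) {u₀ : E} {R T : ℝ}
    (hu₀ : ‖u₀‖ < R) (hT : 0 < T) :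
    ∃ S ∈ Set.Ioc 0 T, ∃ u, u 0 = u₀ ∧ IsIntegralCurveOn u (fun _ => F) (Set.Icc 0 S) ∧
      (S = T ∨ ‖u S‖ = R) := by
  obtain ⟨G, K, L, hK, hL, hGF⟩ :=
    exists_lipschitzWith_bounded_eqOn_closedBall hF ((norm_nonneg _).trans_lt hu₀)
  obtain ⟨u, hu0, hu⟩ := exists_isIntegralCurveOn_Icc_of_lipschitzWith hK hL u₀ hT.le
  have toF : ∀ S ≤ T, (∀ t ∈ Set.Icc 0 S, ‖u t‖ ≤ R) →
      IsIntegralCurveOn u (fun _ => F) (Set.Icc 0 S) := fun S hST hball t ht => by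
    simpa only [hGF (mem_closedBall_zero_iff.2 (hball t ht))] using
      hu.mono (Set.Icc_subset_Icc_right hST) t ht
  by_cases hexit : ∃ t ∈ Set.Icc 0 T, R ≤ ‖u t‖
  · obtain ⟨S, hS, hSR, hlt⟩ := exists_eq_and_forall_lt_of_continuousOn hu.continuousOn.norm
      (hu0.symm ▸ hu₀) hexit
    refine ⟨S, hS, u, hu0, toF S hS.2 fun t ht => ?_, Or.inr hSR⟩
    rcases ht.2.lt_or_eq with hlt' | rfl
    exacts [(hlt t ⟨ht.1, hlt'⟩).le, hSR.le]
  · push Not at hexit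
    exact ⟨T, Set.right_mem_Ioc.2 hT, u, hu0, toF T le_rfl fun t ht => (hexit t ht).le, Or.inl rfl⟩

theorem exists_isIntegralCurveOn_Ici_or_unbounded (hF : ContDiff ℝ 1 F) (u₀ : E) :
    (∃ u, u 0 = u₀ ∧ IsIntegralCurveOn u (fun _ => F) (Set.Ici 0)) ∨
      ∃ T, ∀ R, ∃ S ∈ Set.Ioc 0 T, ∃ u, u 0 = u₀ ∧
        IsIntegralCurveOn u (fun _ => F) (Set.Icc 0 S) ∧ R ≤ ‖u S‖ := by
  by_contra! ⟨hglobal, hbounded⟩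
  refine exists_isIntegralCurveOn_Ici_of_forall_Icc (u₀ := u₀) hF.locallyLipschitz (fun T hT => ?_)
    |>.elim fun u hu => hglobal u hu.1 hu.2
  obtain ⟨R, hR⟩ := hbounded T
  obtain ⟨S, hS, u, hu0, hu, rfl | hexit⟩ := exists_isIntegralCurveOn_Icc_or_norm_eq hF
    (u₀ := u₀) (R := max R ‖u₀‖ + 1) (by linarith [le_max_right R ‖u₀‖]) hT
  · exact ⟨u, hu0, hu⟩
  · linarith [hR S hS u hu0 hu, le_max_left R ‖u₀‖]

end ODE

section Energy

variable {V : ℝ → ℝ} {φ y ρ : ℝ}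

/-- The total energy density of the scalar field and the fluid; the Friedmann constraint reads
`H² + k/a² = energy / 3`, and along expanding cosmologies the energy decreases. -/
noncomputable def energy (V : ℝ → ℝ) (φ y ρ : ℝ) : ℝ :=
  ρ + 1 / 2 * y ^ 2 + V φ

theorem potential_le_energy (hρ : 0 ≤ ρ) : V φ ≤ energy V φ y ρ := by
  unfold energy
  linarith [sq_nonneg y]

theorem sq_velocity_le_energy_sub_potential (hρ : 0 ≤ ρ) :
    y ^ 2 ≤ 2 * (energy V φ y ρ - V φ) := by
  unfold energy
  linarith

theorem density_le_energy_sub_potential : ρ ≤ energy V φ y ρ - V φ := by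
  unfold energy
  linarith [sq_nonneg y]

theorem min_mul_energy_sub_potential_le {γ : ℝ} (hρ : 0 ≤ ρ) :
    min γ 2 * (energy V φ y ρ - V φ) ≤ y ^ 2 + γ * ρ := by
  have hγ : min γ 2 * ρ ≤ γ * ρ := by gcongr; exact min_le_left γ 2
  have hy : min γ 2 * y ^ 2 ≤ 2 * y ^ 2 := by gcongr; exact min_le_right γ 2
  unfold energy
  linarith

/-- The states of expanding cosmologies with `φ > M` whose energy lies below the barrier `V M`,
so that `φ` cannot return to `M`. -/
def trappingRegion (V : ℝ → ℝ) (M : ℝ) : Set (ℝ × ℝ × ℝ × ℝ) :=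
  {p | M < p.1 ∧ 0 ≤ p.2.2.1 ∧ 0 < p.2.2.2 ∧ energy V p.1 p.2.1 p.2.2.1 < V M}

end Energy

namespace IsCosmology

variable {V : ℝ → ℝ} {γ k : ℝ} {s : Set ℝ} {a φ y ρ H : ℝ → ℝ} {t : ℝ}

theorem mono {s' : Set ℝ} (h : IsCosmology V γ k s a φ y ρ H) (hs : s' ⊆ s) :
    IsCosmology V γ k s' a φ y ρ H where
  scale_pos t ht := h.scale_pos t (hs ht)
  hubble t ht := (h.hubble t (hs ht)).mono hs
  velocity t ht := (h.velocity t (hs ht)).mono hs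
  motion t ht := (h.motion t (hs ht)).mono hs
  conservation t ht := (h.conservation t (hs ht)).mono hs
  raychaudhuri t ht := (h.raychaudhuri t (hs ht)).mono hs
  friedmann t ht := h.friedmann t (hs ht)

theorem hasDerivWithinAt_log_scale (h : IsCosmology V γ k s a φ y ρ H) (ht : t ∈ s) :
    HasDerivWithinAt (fun t => Real.log (a t)) (H t) s t :=
  ((h.hubble t ht).log (h.scale_pos t ht).ne').congr_deriv
    (mul_div_cancel_left₀ _ (h.scale_pos t ht).ne')

theorem hasDerivWithinAt_energy (h : IsCosmology V γ k s a φ y ρ H) (hV : Differentiable ℝ V)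
    (ht : t ∈ s) :
    HasDerivWithinAt (fun t => energy V (φ t) (y t) (ρ t))
      (-3 * H t * (y t ^ 2 + γ * ρ t)) s t := by
  refine (((h.conservation t ht).add (((h.motion t ht).pow 2).const_mul (1 / 2))).add
    ((hV (φ t)).hasDerivAt.comp_hasDerivWithinAt t (h.velocity t ht))).congr_deriv ?_
  simp only [Nat.cast_ofNat, Nat.add_one_sub_one, pow_one]
  ring

theorem curvature_nonpos (h : IsCosmology V γ k s a φ y ρ H) (hk : k ≤ 0) (ht : t ∈ s) :
    k / a t ^ 2 ≤ 0 :=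
  div_nonpos_of_nonpos_of_nonneg hk (pow_nonneg (h.scale_pos t ht).le 2)

theorem energy_le_three_mul_hubble_sq (h : IsCosmology V γ k s a φ y ρ H) (hk : k ≤ 0)
    (ht : t ∈ s) : energy V (φ t) (y t) (ρ t) ≤ 3 * H t ^ 2 := by
  have hcurv := h.curvature_nonpos hk ht
  have hfried := h.friedmann t ht
  unfold energy
  linarith

section Convex

variable (h : IsCosmology V γ k s a φ y ρ H) (hs : Convex ℝ s) (h0 : (0 : ℝ) ∈ s) (hρ : 0 ≤ ρ 0)

include h hs h0 hρ

-- `ρ a^{3γ} e^{αφ}` is constant.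
theorem density_nonneg (ht : t ∈ s) : 0 ≤ ρ t := by
  have hconst : ∀ r ∈ s, HasDerivWithinAt
      (fun r => ρ r * Real.exp (3 * γ * Real.log (a r) + coupling γ * φ r)) 0 s r := by
    intro r hr
    refine ((h.conservation r hr).mul ((((h.hasDerivWithinAt_log_scale hr).const_mul (3 * γ)).add
      ((h.velocity r hr).const_mul (coupling γ))).exp)).congr_deriv ?_
    simp only [Pi.add_apply]
    ring
  have heq := eq_of_forall_hasDerivWithinAt_zero hs hconst h0 ht
  exact nonneg_of_mul_nonneg_left (heq ▸ mul_nonneg hρ (Real.exp_nonneg _)) (Real.exp_pos _)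

theorem dissipation_nonneg (hγ : 0 ≤ γ) (ht : t ∈ s) : 0 ≤ y t ^ 2 + γ * ρ t :=
  add_nonneg (sq_nonneg _) (mul_nonneg hγ (h.density_nonneg hs h0 hρ ht))

theorem hubble_antitoneOn (hγ : 0 ≤ γ) (hk : k ≤ 0) : AntitoneOn H s :=
  antitoneOn_of_forall_hasDerivWithinAt_nonpos hs h.raychaudhuri fun t ht => by
    linarith [h.dissipation_nonneg hs h0 hρ hγ ht, h.curvature_nonpos hk ht]

theorem energy_antitoneOn (hV : Differentiable ℝ V) (hγ : 0 ≤ γ) (hH : ∀ t ∈ s, 0 ≤ H t) :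
    AntitoneOn (fun t => energy V (φ t) (y t) (ρ t)) s :=
  antitoneOn_of_forall_hasDerivWithinAt_nonpos hs (fun _ => h.hasDerivWithinAt_energy hV)
    fun t ht => by
      linarith [mul_nonneg (hH t ht) (h.dissipation_nonneg hs h0 hρ hγ ht)]

end Convex

theorem sqrt_le_hubble {ℓ : ℝ} (h : IsCosmology V γ k s a φ y ρ H) (hk : k ≤ 0) (ht : t ∈ s)
    (hH : 0 ≤ H t) (hℓ : ℓ ≤ energy V (φ t) (y t) (ρ t)) : √(ℓ / 3) ≤ H t :=
  Real.sqrt_le_iff.2 ⟨hH, by linarith [h.energy_le_three_mul_hubble_sq hk ht]⟩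

section Trapping

variable {M : ℝ} (hV : Differentiable ℝ V) (hγ : 0 ≤ γ) (hk : k ≤ 0)
  (hVpos : ∀ x, M ≤ x → 0 < V x) (hstart : (φ 0, y 0, ρ 0, H 0) ∈ trappingRegion V M)

include hV hγ hk hVpos hstart

theorem forall_lt_field_and_hubble_pos {T : ℝ}
    (h : IsCosmology V γ k (Set.Icc 0 T) a φ y ρ H) : ∀ t ∈ Set.Icc 0 T, M < φ t ∧ 0 < H t := by
  obtain ⟨hφ, hρ, hH, hE⟩ := hstart
  simp only at hφ hρ hH hE
  by_contra! hexit
  obtain ⟨τ, ⟨hτ0, hτT⟩, hτ, hbefore⟩ := exists_eq_and_forall_lt_of_continuousOn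
    (f := fun t => max (M - φ t) (-H t)) (c := 0)
    ((continuousOn_const.sub (HasDerivWithinAt.continuousOn h.velocity)).sup
      (HasDerivWithinAt.continuousOn h.raychaudhuri).neg) (by simp [hφ, hH]) (by
      obtain ⟨t, ht, hout⟩ := hexit
      refine ⟨t, ht, le_max_iff.2 ?_⟩
      rcases le_or_gt (φ t) M with hle | hlt
      exacts [Or.inl (sub_nonneg.2 hle), Or.inr (neg_nonneg.2 (hout hlt))])
  have hle : ∀ t ∈ Set.Icc 0 τ, max (M - φ t) (-H t) ≤ 0 := fun t ht =>
    ht.2.lt_or_eq.elim (fun hlt => (hbefore t ⟨ht.1, hlt⟩).le) (fun heq => heq ▸ hτ.le)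
  have hτmem : τ ∈ Set.Icc 0 τ := Set.right_mem_Icc.2 hτ0.le
  have h0mem : (0 : ℝ) ∈ Set.Icc 0 τ := Set.left_mem_Icc.2 hτ0.le
  have h' := h.mono (Set.Icc_subset_Icc_right hτT)
  have hEτ := h'.energy_antitoneOn (convex_Icc 0 τ) h0mem hρ hV hγ
    (fun t ht => neg_nonpos.1 ((le_max_right _ _).trans (hle t ht))) h0mem hτmem hτ0.le
  have hVE := potential_le_energy (V := V) (φ := φ τ) (y := y τ)
    (h'.density_nonneg (convex_Icc 0 τ) h0mem hρ hτmem)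
  rcases max_choice (M - φ τ) (-H τ) with hfield | hhubble
  · have hφτ : φ τ = M := by linarith
    simp only [hφτ] at hVE hEτ
    linarith
  · have hHτ : H τ = 0 := by linarith
    have henergy := h'.energy_le_three_mul_hubble_sq hk hτmem
    have hφτ : M ≤ φ τ := sub_nonpos.1 ((le_max_left _ _).trans hτ.le)
    rw [hHτ] at henergy
    linarith [hVpos _ hφτ]

theorem mem_trappingRegion (h : IsCosmology V γ k s a φ y ρ H) (hs : Convex ℝ s)
    (h0 : (0 : ℝ) ∈ s) (ht : t ∈ s) (h0t : 0 ≤ t) : (φ t, y t, ρ t, H t) ∈ trappingRegion V M := by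
  have h' := h.mono (hs.ordConnected.out h0 ht)
  have hstay := h'.forall_lt_field_and_hubble_pos hV hγ hk hVpos hstart
  have h0mem : (0 : ℝ) ∈ Set.Icc 0 t := Set.left_mem_Icc.2 h0t
  have htmem : t ∈ Set.Icc 0 t := Set.right_mem_Icc.2 h0t
  obtain ⟨-, hρ, -, hE⟩ := hstart
  exact ⟨(hstay t htmem).1, h.density_nonneg hs h0 hρ ht, (hstay t htmem).2,
    (h'.energy_antitoneOn (convex_Icc 0 t) h0mem hρ hV hγ (fun r hr => (hstay r hr).2.le)
      h0mem htmem h0t).trans_lt hE⟩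

end Trapping

end IsCosmology

section Existence

variable {V : ℝ → ℝ} {γ k : ℝ}

/-- The equations of motion as an autonomous equation for `(log a, φ, y, ρ, H)`; passing to `log a`
keeps the scale factor positive and makes the vector field defined everywhere. -/
noncomputable def cosmologyField (V : ℝ → ℝ) (γ k : ℝ) (u : ℝ × ℝ × ℝ × ℝ × ℝ) :
    ℝ × ℝ × ℝ × ℝ × ℝ :=
  (u.2.2.2.2, u.2.2.1,
    -3 * u.2.2.2.2 * u.2.2.1 - deriv V u.2.1 + coupling γ * u.2.2.2.1,
    -3 * γ * u.2.2.2.1 * u.2.2.2.2 - coupling γ * u.2.2.2.1 * u.2.2.1,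
    -(1 / 2) * u.2.2.1 ^ 2 - γ / 2 * u.2.2.2.1 + k / Real.exp u.1 ^ 2)

theorem contDiff_cosmologyField (hV : ContDiff ℝ 2 V) (γ k : ℝ) :
    ContDiff ℝ 1 (cosmologyField V γ k) := by
  have hV' : ContDiff ℝ 1 (deriv V) := by
    rw [← one_add_one_eq_two] at hV
    exact (contDiff_succ_iff_deriv.1 hV).2.2
  unfold cosmologyField
  fun_prop (disch := intro; positivity)

/-- The amount by which the Friedmann constraint fails at a state `(log a, φ, y, ρ, H)`; it is a
first integral of `cosmologyField`. -/
noncomputable def friedmannDefect (V : ℝ → ℝ) (k : ℝ) (u : ℝ × ℝ × ℝ × ℝ × ℝ) : ℝ :=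
  u.2.2.2.2 ^ 2 + k / Real.exp u.1 ^ 2 - 1 / 3 * energy V u.2.1 u.2.2.1 u.2.2.2.1

theorem hasDerivWithinAt_friedmannDefect (hV : Differentiable ℝ V) {s : Set ℝ}
    {u : ℝ → ℝ × ℝ × ℝ × ℝ × ℝ} (hu : IsIntegralCurveOn u (fun _ => cosmologyField V γ k) s) {t : ℝ}
    (ht : t ∈ s) : HasDerivWithinAt (fun t => friedmannDefect V k (u t)) 0 s t := by
  have hlog : HasDerivWithinAt (fun t => (u t).1) _ s t := (hu t ht).fst
  have hφ : HasDerivWithinAt (fun t => (u t).2.1) _ s t := (hu t ht).snd.fst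
  have hy : HasDerivWithinAt (fun t => (u t).2.2.1) _ s t := (hu t ht).snd.snd.fst
  have hρ : HasDerivWithinAt (fun t => (u t).2.2.2.1) _ s t := (hu t ht).snd.snd.snd.fst
  have hH : HasDerivWithinAt (fun t => (u t).2.2.2.2) _ s t := (hu t ht).snd.snd.snd.snd
  have henergy := (hρ.add ((hy.pow 2).const_mul (1 / 2))).add
    ((hV _).hasDerivAt.comp_hasDerivWithinAt t hφ)
  have hcurv := ((hlog.exp.fun_pow 2).fun_inv (pow_pos (Real.exp_pos _) 2).ne').const_mul k
  refine (((hH.pow 2).add hcurv).sub (henergy.const_mul (1 / 3))).congr_deriv ?_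
  simp only [cosmologyField, Nat.cast_ofNat, Nat.add_one_sub_one, pow_one]
  field_simp
  ring

theorem isCosmology_of_isIntegralCurveOn (hV : Differentiable ℝ V) {s : Set ℝ} (hs : Convex ℝ s)
    (h0 : (0 : ℝ) ∈ s) {u : ℝ → ℝ × ℝ × ℝ × ℝ × ℝ}
    (hu : IsIntegralCurveOn u (fun _ => cosmologyField V γ k) s)
    (hconstraint : friedmannDefect V k (u 0) = 0) :
    IsCosmology V γ k s (fun t => Real.exp (u t).1) (fun t => (u t).2.1) (fun t => (u t).2.2.1)
      (fun t => (u t).2.2.2.1) (fun t => (u t).2.2.2.2) where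
  scale_pos _ _ := Real.exp_pos _
  hubble t ht := HasDerivWithinAt.exp (f := fun t => (u t).1) (hu t ht).fst
  velocity t ht := (hu t ht).snd.fst
  motion t ht := (hu t ht).snd.snd.fst
  conservation t ht := (hu t ht).snd.snd.snd.fst
  raychaudhuri t ht := (hu t ht).snd.snd.snd.snd
  friedmann _ ht := sub_eq_zero.1 <|
    (eq_of_forall_hasDerivWithinAt_zero hs (fun _ => hasDerivWithinAt_friedmannDefect hV hu) ht
      h0).trans hconstraint

theorem IsCosmology.norm_le {T C : ℝ} {a φ y ρ H : ℝ → ℝ}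
    (h : IsCosmology V γ k (Set.Icc 0 T) a φ y ρ H) (hT : 0 ≤ T)
    (hC : ∀ t ∈ Set.Icc 0 T, |y t| ≤ C ∧ |ρ t| ≤ C ∧ |H t| ≤ C) :
    ‖(Real.log (a T), φ T, y T, ρ T, H T)‖ ≤ |Real.log (a 0)| + |φ 0| + C * T + C := by
  obtain ⟨hyT, hρT, hHT⟩ := hC T (Set.right_mem_Icc.2 hT)
  have hC0 : 0 ≤ C := (abs_nonneg _).trans hyT
  have hφ := norm_le_norm_add_mul_of_norm_hasDerivWithinAt_le hT h.velocity fun t ht => (hC t ht).1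
  have hlog := norm_le_norm_add_mul_of_norm_hasDerivWithinAt_le hT
    (fun _ => h.hasDerivWithinAt_log_scale) fun t ht => (hC t ht).2.2
  rw [sub_zero] at hφ hlog
  have hlog0 := abs_nonneg (Real.log (a 0))
  have hφ0 := abs_nonneg (φ 0)
  have hCT : 0 ≤ C * T := mul_nonneg hC0 hT
  simp only [norm_prod_le_iff, Real.norm_eq_abs] at hφ hlog ⊢
  exact ⟨by linarith, by linarith, by linarith, by linarith, by linarith⟩

theorem existsGlobally_or_unbounded (hV : ContDiff ℝ 2 V) (γ : ℝ) {a₀ : ℝ} (ha₀ : 0 < a₀)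
    {p : ℝ × ℝ × ℝ × ℝ}
    (hp : p.2.2.2 ^ 2 + k / a₀ ^ 2 = 1 / 3 * energy V p.1 p.2.1 p.2.2.1) :
    ExistsGlobally V γ k p ∨ ∀ C, ∃ S, 0 ≤ S ∧ ∃ a φ y ρ H : ℝ → ℝ,
      IsCosmology V γ k (Set.Icc 0 S) a φ y ρ H ∧ StartsAt p φ y ρ H ∧
      ¬(|y S| ≤ C ∧ |ρ S| ≤ C ∧ |H S| ≤ C) := by
  have hVdiff := hV.differentiable two_ne_zero
  have hdefect : friedmannDefect V k (Real.log a₀, p) = 0 := by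
    simp only [friedmannDefect, Real.exp_log ha₀, hp, sub_self]
  rcases exists_isIntegralCurveOn_Ici_or_unbounded (contDiff_cosmologyField hV γ k)
    (Real.log a₀, p) with ⟨u, hu0, hu⟩ | ⟨T, hunbounded⟩
  · exact Or.inl ⟨_, _, _, _, _, isCosmology_of_isIntegralCurveOn hVdiff (convex_Ici 0)
      Set.self_mem_Ici hu (hu0 ▸ hdefect), congrArg Prod.snd hu0⟩
  · refine Or.inr fun C => ?_
    by_contra! hbounded
    obtain ⟨S, ⟨hS0, hST⟩, u, hu0, hu, hlarge⟩ :=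
      hunbounded (|Real.log a₀| + |p.1| + C * T + C + 1)
    have hcosmology := isCosmology_of_isIntegralCurveOn hVdiff (convex_Icc 0 S)
      (Set.left_mem_Icc.2 hS0.le) hu (hu0 ▸ hdefect)
    have hC : ∀ t ∈ Set.Icc 0 S, |(u t).2.2.1| ≤ C ∧ |(u t).2.2.2.1| ≤ C ∧ |(u t).2.2.2.2| ≤ C :=
      fun t ht => hbounded t ht.1 _ _ _ _ _ (hcosmology.mono (Set.Icc_subset_Icc_right ht.2))
        (congrArg Prod.snd hu0)
    have hnorm := hcosmology.norm_le hS0.le hC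
    have hC0 : 0 ≤ C := (abs_nonneg _).trans (hC 0 (Set.left_mem_Icc.2 hS0.le)).1
    have hCT : C * S ≤ C * T := by gcongr
    simp only [Real.log_exp, hu0, Prod.mk.eta] at hnorm
    linarith

end Existence

section Potential

variable {V : ℝ → ℝ} {ℓ : ℝ}

theorem eventually_deriv_neg_of_tendsto_nhdsGT (hV : Differentiable ℝ V)
    (hcrit : ∀ᶠ x in atTop, deriv V x ≠ 0) (hVℓ : Tendsto V atTop (𝓝[>] ℓ)) :
    ∀ᶠ x in atTop, deriv V x < 0 := by
  obtain ⟨M, hM⟩ := eventually_atTop.1 (hcrit.and (hVℓ.eventually self_mem_nhdsWithin))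
  rcases hasDerivWithinAt_forall_lt_or_forall_gt_of_forall_ne (convex_Ici M)
    (fun x _ => (hV x).hasDerivAt.hasDerivWithinAt) (fun x hx => (hM x hx).1) with hneg | hpos
  · exact (eventually_ge_atTop M).mono hneg
  · have hmono := strictMonoOn_of_deriv_pos (convex_Ici M) hV.continuous.continuousOn
      fun x hx => hpos x (interior_subset hx)
    have hle : V M ≤ ℓ := ge_of_tendsto (tendsto_nhds_of_tendsto_nhdsWithin hVℓ) <|
      (eventually_ge_atTop M).mono fun x hx => hmono.monotoneOn Set.self_mem_Ici hx hx
    exact absurd hle (hM M le_rfl).2.not_ge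

theorem eventually_deriv_pos_of_tendsto_nhdsLT (hV : Differentiable ℝ V)
    (hcrit : ∀ᶠ x in atTop, deriv V x ≠ 0) (hVℓ : Tendsto V atTop (𝓝[<] ℓ)) :
    ∀ᶠ x in atTop, 0 < deriv V x := by
  have hneg := eventually_deriv_neg_of_tendsto_nhdsGT (V := fun x => -V x) (ℓ := -ℓ) hV.neg
    (by simpa only [deriv.fun_neg, neg_ne_zero] using hcrit) (tendsto_neg_nhdsLT.comp hVℓ)
  simpa only [deriv.fun_neg, neg_lt_zero] using hneg

theorem tendsto_atTop_of_strictAntiOn_comp {ι : Type*} {l : Filter ι} {f : ℝ → ℝ} {M : ℝ}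
    {φ : ι → ℝ} (hf : StrictAntiOn f (Set.Ici M)) (hℓ : ∀ x, M ≤ x → ℓ < f x)
    (hφ : ∀ᶠ t in l, M ≤ φ t) (hlim : Tendsto (fun t => f (φ t)) l (𝓝 ℓ)) : Tendsto φ l atTop := by
  refine tendsto_atTop.2 fun B => ?_
  filter_upwards [hφ, hlim.eventually (gt_mem_nhds (hℓ (max M B) (le_max_left M B)))] with t ht hlt
  exact (le_max_right M B).trans ((hf.lt_iff_gt ht (le_max_left M B)).1 hlt).le

theorem IsAdmissiblePotential.eventually_deriv_ne_zero (hV : IsAdmissiblePotential V) :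
    ∀ᶠ x in atTop, deriv V x ≠ 0 := by
  obtain ⟨M, hM⟩ := hV.finite_crit.bddAbove
  filter_upwards [eventually_gt_atTop M] with x hx hcrit using hx.not_ge (hM hcrit)

theorem IsAdmissiblePotential.limit_pos (hV : IsAdmissiblePotential V)
    (hVℓ : Tendsto V atTop (𝓝[<] ℓ)) : 0 < ℓ := by
  obtain ⟨M, hM⟩ := hV.bounded_neg.bddAbove
  obtain ⟨x, hx, hxℓ⟩ :=
    ((eventually_gt_atTop M).and (hVℓ.eventually self_mem_nhdsWithin)).exists
  exact (not_lt.1 fun hneg => hx.not_ge (hM hneg)).trans_lt hxℓ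

theorem contDiff_exponential (V₀ lam : ℝ) {n : WithTop ℕ∞} :
    ContDiff ℝ n fun x => V₀ * Real.exp (-lam * x) := by
  fun_prop

theorem deriv_exponential_ne_zero {V₀ lam : ℝ} (hV₀ : V₀ ≠ 0) (hlam : lam ≠ 0) (x : ℝ) :
    deriv (fun x => V₀ * Real.exp (-lam * x)) x ≠ 0 := by
  have hderiv : HasDerivAt (fun x => V₀ * Real.exp (-lam * x))
      (V₀ * (Real.exp (-lam * x) * (-lam * 1))) x :=
    (((hasDerivAt_id x).const_mul (-lam)).exp).const_mul V₀
  rw [hderiv.deriv, mul_one]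
  exact mul_ne_zero hV₀ (mul_ne_zero (Real.exp_ne_zero _) (neg_ne_zero.2 hlam))

theorem tendsto_exponential_nhdsGT {V₀ lam : ℝ} (hV₀ : 0 < V₀) (hlam : 0 < lam) :
    Tendsto (fun x => V₀ * Real.exp (-lam * x)) atTop (𝓝[>] 0) := by
  refine tendsto_nhdsWithin_iff.2
    ⟨?_, Eventually.of_forall fun x => mul_pos hV₀ (Real.exp_pos _)⟩
  have hexp : Tendsto (fun x => Real.exp (-lam * x)) atTop (𝓝 0) :=
    Real.tendsto_exp_atBot.comp (tendsto_id.const_mul_atTop_of_neg (neg_lt_zero.2 hlam))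
  simpa only [mul_zero] using hexp.const_mul V₀

end Potential

section Dissipation

theorem abs_friction_le {α γ c h y ρ H : ℝ} (hγ : 0 < γ) (hc : 0 < c) (hρ : 0 ≤ ρ) (hH : |H| ≤ h) :
    |-3 * H * y + α * ρ| ≤ c / 2 + (9 * h ^ 2 / (2 * c) + |α| / γ) * (y ^ 2 + γ * ρ) := by
  have hh : 0 ≤ h := (abs_nonneg H).trans hH
  -- AM-GM for `c` and `9 h² y² / c`.
  have hfriction : 3 * h * |y| ≤ c / 2 + 9 * h ^ 2 / (2 * c) * y ^ 2 := by
    have hsq : 0 ≤ (c - 3 * h * |y|) ^ 2 / (2 * c) := by positivity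
    have hexpand : (c - 3 * h * |y|) ^ 2 / (2 * c)
        = c / 2 + 9 * h ^ 2 / (2 * c) * y ^ 2 - 3 * h * |y| := by
      rw [← sq_abs y]
      field_simp
      ring
    linarith
  have hcoupling : |α| * ρ = |α| / γ * (γ * ρ) := by field_simp
  have hcross₁ : 0 ≤ 9 * h ^ 2 / (2 * c) * (γ * ρ) := by positivity
  have hcross₂ : 0 ≤ |α| / γ * y ^ 2 := by positivity
  calc |-3 * H * y + α * ρ| ≤ 3 * |H| * |y| + |α| * ρ := by
        refine (abs_add_le _ _).trans_eq ?_
        rw [abs_mul, abs_mul, abs_mul, abs_of_nonneg hρ, abs_neg, Nat.abs_ofNat]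
    _ ≤ 3 * h * |y| + |α| * ρ := by gcongr
    _ ≤ _ := by linarith

variable {V : ℝ → ℝ} {γ k : ℝ} {a φ y ρ H : ℝ → ℝ}

theorem IsCosmology.exists_force_add_dissipation_lt (h : IsCosmology V γ k (Set.Ici 0) a φ y ρ H)
    (hV : Differentiable ℝ V) (hγ : 0 < γ) (hk : k ≤ 0) (hρ : 0 ≤ ρ 0)
    (hVnonneg : ∀ t, 0 ≤ t → 0 ≤ V (φ t)) {h₀ : ℝ} (hh₀ : 0 < h₀) (hH : ∀ t, 0 ≤ t → h₀ ≤ H t)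
    {σ B c : ℝ} (hσ : |σ| ≤ 1) (hB : 0 ≤ B) (hc : 0 < c) :
    ∃ t, 0 ≤ t ∧ σ * deriv V (φ t) + B * (y t ^ 2 + γ * ρ t) < c := by
  by_contra! hforce
  have h0 : (0 : ℝ) ∈ Set.Ici 0 := Set.self_mem_Ici
  have hHnonneg : ∀ t ∈ Set.Ici (0 : ℝ), 0 ≤ H t := fun t ht => hh₀.le.trans (hH t ht)
  have hρ' : ∀ t ∈ Set.Ici 0, 0 ≤ ρ t := fun t => h.density_nonneg (convex_Ici 0) h0 hρ
  set A := 9 * H 0 ^ 2 / (2 * c) + |coupling γ| / γ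
  set K := (A + B) / (3 * h₀) with hK
  have hK0 : 0 ≤ K := by positivity
  have hKh₀ : 3 * K * h₀ = A + B := by rw [hK]; field_simp
  -- `-σ y - K E` increases at rate `c / 2`: dissipation of energy pays for the friction terms.
  have hgrowth : Tendsto (fun t => -σ * y t - K * energy V (φ t) (y t) (ρ t)) atTop atTop := by
    refine tendsto_atTop_of_le_hasDerivWithinAt (half_pos hc) (fun t ht =>
      ((h.motion t ht).const_mul (-σ)).sub ((h.hasDerivWithinAt_energy hV ht).const_mul K))
      fun t ht => ?_
    have hD := h.dissipation_nonneg (convex_Ici 0) h0 hρ hγ.le ht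
    have hfriction := abs_friction_le (α := coupling γ) (y := y t) hγ hc (hρ' t ht)
      ((abs_of_nonneg (hHnonneg t ht)).trans_le
        (h.hubble_antitoneOn (convex_Ici 0) h0 hρ hγ.le hk h0 ht ht))
    have hσfriction := (abs_le.1 ((abs_mul _ _).trans_le
      (mul_le_of_le_one_left (abs_nonneg (-3 * H t * y t + coupling γ * ρ t)) hσ))).2
    have hdissipation : 3 * K * h₀ * (y t ^ 2 + γ * ρ t) ≤ 3 * K * H t * (y t ^ 2 + γ * ρ t) := by
      gcongr
      exact hH t ht
    rw [hKh₀] at hdissipation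
    linarith [hforce t ht]
  obtain ⟨t, hlarge, ht⟩ :=
    ((hgrowth.eventually_gt_atTop (1 / 2 + energy V (φ 0) (y 0) (ρ 0))).and
      (eventually_ge_atTop 0)).exists
  have hEnonneg := (hVnonneg t ht).trans (potential_le_energy (y := y t) (hρ' t ht))
  have hE := h.energy_antitoneOn (convex_Ici 0) h0 hρ hV hγ.le hHnonneg h0 ht ht
  have hy := (abs_le.1 ((abs_mul σ (y t)).trans_le (mul_le_of_le_one_left (abs_nonneg _) hσ))).1
  have hy2 := sq_velocity_le_energy_sub_potential (V := V) (φ := φ t) (y := y t) (hρ' t ht)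
  linarith [mul_nonneg hK0 hEnonneg, sq_nonneg (|y t| - 1), sq_abs (y t), hVnonneg t ht]

end Dissipation

section Convergence

variable {V : ℝ → ℝ} {γ k ℓ M : ℝ} {a φ y ρ H : ℝ → ℝ}

theorem IsCosmology.tendsto_curvature (h : IsCosmology V γ k (Set.Ici 0) a φ y ρ H) (hγ : 0 ≤ γ)
    (hk : k ≤ 0) (hρ : 0 ≤ ρ 0) (hH : ∀ t, 0 ≤ t → 0 ≤ H t) :
    Tendsto (fun t => k / a t ^ 2) atTop (𝓝 0) := by
  refine tendsto_order.2 ⟨fun ε hε => ?_, fun ε hε => ?_⟩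
  · -- Otherwise the Raychaudhuri equation would make `H` negative.
    obtain ⟨r, hr0, hr⟩ : ∃ r, 0 ≤ r ∧ ε < k / a r ^ 2 := by
      by_contra! hcurv
      have hdecay := tendsto_atTop_of_le_hasDerivWithinAt (neg_pos.2 hε)
        (fun t ht => (h.raychaudhuri t ht).neg) fun t ht => by
          linarith [hcurv t ht, h.dissipation_nonneg (convex_Ici 0) Set.self_mem_Ici hρ hγ ht]
      obtain ⟨t, hneg, ht⟩ :=
        ((hdecay.eventually_gt_atTop 0).and (eventually_ge_atTop 0)).exists
      exact (hH t ht).not_gt (neg_pos.1 hneg)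
    have hmono : MonotoneOn a (Set.Ici 0) :=
      monotoneOn_of_forall_hasDerivWithinAt_nonneg (convex_Ici 0) h.hubble fun t ht =>
        mul_nonneg (h.scale_pos t ht).le (hH t ht)
    filter_upwards [eventually_ge_atTop r] with t ht
    have har := h.scale_pos r hr0
    have hle : a r ≤ a t := hmono hr0 (hr0.trans ht) ht
    calc ε < k / a r ^ 2 := hr
      _ ≤ k / a t ^ 2 := by
        rw [div_eq_mul_inv, div_eq_mul_inv]
        exact mul_le_mul_of_nonpos_left (by gcongr) hk
  · filter_upwards [eventually_ge_atTop 0] with t ht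
    exact (h.curvature_nonpos hk ht).trans_lt hε

section Trapped

variable (h : IsCosmology V γ k (Set.Ici 0) a φ y ρ H) (hlim : Tendsto V atTop (𝓝 ℓ))
  (hγ : 0 < γ) (hk : k ≤ 0) (hℓ : 0 ≤ ℓ) (hVℓ : ∀ x, M ≤ x → ℓ < V x)
  (hV' : ∀ x, M ≤ x → deriv V x < 0)
  (htrap : ∀ t, 0 ≤ t → (φ t, y t, ρ t, H t) ∈ trappingRegion V M)

include h hlim hγ hk hℓ hVℓ hV' htrap

theorem IsCosmology.exists_energy_lt (hV : ContDiff ℝ 1 V) {ε : ℝ} (hε : 0 < ε) :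
    ∃ t, 0 ≤ t ∧ energy V (φ t) (y t) (ρ t) < ℓ + ε := by
  by_contra! hE
  have hVdiff := hV.differentiable one_ne_zero
  obtain ⟨M', hM'⟩ := eventually_atTop.1
    (hlim.eventually (gt_mem_nhds (lt_add_of_pos_right ℓ (half_pos hε))))
  obtain ⟨c, hc, hforce : ∀ x ∈ Set.Icc M M', c ≤ -deriv V x⟩ :=
    (isCompact_Icc (a := M) (b := M')).exists_forall_le'
      hV.continuous_deriv_one.neg.continuousOn fun x hx => neg_pos.2 (hV' x hx.1)
  have hμ : 0 < min γ 2 := lt_min hγ two_pos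
  obtain ⟨t, ht, hlt⟩ := h.exists_force_add_dissipation_lt hVdiff hγ hk (htrap 0 le_rfl).2.1
    (fun t ht => hℓ.trans (hVℓ _ (htrap t ht).1.le).le) (h₀ := √((ℓ + ε) / 3)) (by positivity)
    (fun t ht => h.sqrt_le_hubble hk ht (htrap t ht).2.2.1.le (hE t ht))
    (σ := -1) (B := c / (min γ 2 * (ε / 2))) (by norm_num) (by positivity) hc
  have hV't : deriv V (φ t) < 0 := hV' _ (htrap t ht).1.le
  have hρ : ∀ t, 0 ≤ t → 0 ≤ ρ t := fun t ht => (htrap t ht).2.1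
  have hdissipation := min_mul_energy_sub_potential_le (V := V) (φ := φ t) (y := y t) (γ := γ)
    (hρ t ht)
  rcases le_or_gt (φ t) M' with hle | hgt
  · have hD := h.dissipation_nonneg (convex_Ici 0) Set.self_mem_Ici (hρ 0 le_rfl) hγ.le ht
    have hBD : 0 ≤ c / (min γ 2 * (ε / 2)) * (y t ^ 2 + γ * ρ t) := by positivity
    linarith [hforce (φ t) ⟨(htrap t ht).1.le, hle⟩]
  · have hgap : ε / 2 ≤ energy V (φ t) (y t) (ρ t) - V (φ t) := by
      linarith [hE t ht, hM' _ hgt.le]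
    have hcBD : c ≤ c / (min γ 2 * (ε / 2)) * (y t ^ 2 + γ * ρ t) :=
      calc c = c / (min γ 2 * (ε / 2)) * (min γ 2 * (ε / 2)) := by field_simp
        _ ≤ c / (min γ 2 * (ε / 2)) * (y t ^ 2 + γ * ρ t) := by
          gcongr
          exact (mul_le_mul_of_nonneg_left hgap hμ.le).trans hdissipation
    linarith

theorem IsCosmology.tendsto_energy (hV : ContDiff ℝ 1 V) :
    Tendsto (fun t => energy V (φ t) (y t) (ρ t)) atTop (𝓝 ℓ) := by
  have hVdiff := hV.differentiable one_ne_zero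
  have hanti := h.energy_antitoneOn (convex_Ici 0) Set.self_mem_Ici (htrap 0 le_rfl).2.1 hVdiff
    hγ.le fun t ht => (htrap t ht).2.2.1.le
  refine tendsto_order.2 ⟨fun b hb => ?_, fun b hb => ?_⟩
  · filter_upwards [eventually_ge_atTop 0] with t ht
    exact hb.trans ((hVℓ _ (htrap t ht).1.le).trans_le (potential_le_energy (htrap t ht).2.1))
  · obtain ⟨r, hr, hlt⟩ := h.exists_energy_lt hlim hγ hk hℓ hVℓ hV' htrap hV (sub_pos.2 hb)
    rw [add_sub_cancel] at hlt
    filter_upwards [eventually_ge_atTop r] with t ht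
    exact (hanti hr (hr.trans ht) ht).trans_lt hlt

theorem IsCosmology.convergesToInfinity (hV : ContDiff ℝ 1 V) :
    ConvergesToInfinity ℓ φ y ρ H := by
  have hVdiff := hV.differentiable one_ne_zero
  have htrap' : ∀ᶠ t in atTop, (φ t, y t, ρ t, H t) ∈ trappingRegion V M :=
    (eventually_ge_atTop 0).mono htrap
  have hVφ : ∀ᶠ t in atTop, ℓ < V (φ t) := htrap'.mono fun t ht => hVℓ _ ht.1.le
  have hE := h.tendsto_energy hlim hγ hk hℓ hVℓ hV' htrap hV
  have hpotential : Tendsto (fun t => V (φ t)) atTop (𝓝 ℓ) :=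
    tendsto_of_tendsto_of_tendsto_of_le_of_le' tendsto_const_nhds hE (hVφ.mono fun t ht => ht.le)
      (htrap'.mono fun t ht => potential_le_energy ht.2.1)
  have hgap : Tendsto (fun t => energy V (φ t) (y t) (ρ t) - V (φ t)) atTop (𝓝 0) := by
    simpa only [sub_self] using hE.sub hpotential
  have hanti := strictAntiOn_of_deriv_neg (convex_Ici M) hVdiff.continuous.continuousOn
    fun x hx => hV' x (interior_subset hx)
  refine ⟨tendsto_atTop_of_strictAntiOn_comp hanti hVℓ (htrap'.mono fun t ht => ht.1.le)
    hpotential, ?_, ?_, ?_⟩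
  · have hy2 : Tendsto (fun t => y t ^ 2) atTop (𝓝 0) :=
      squeeze_zero' (Eventually.of_forall fun t => sq_nonneg (y t))
        (htrap'.mono fun t ht => sq_velocity_le_energy_sub_potential ht.2.1)
        (by simpa only [mul_zero] using hgap.const_mul 2)
    have habs := hy2.sqrt
    simp only [Real.sqrt_sq_eq_abs, Real.sqrt_zero] at habs
    exact (tendsto_zero_iff_abs_tendsto_zero y).2 habs
  · exact squeeze_zero' (htrap'.mono fun t ht => ht.2.1)
      (Eventually.of_forall fun t => density_le_energy_sub_potential) hgap
  · have hcurv := h.tendsto_curvature hγ.le hk (htrap 0 le_rfl).2.1 fun t ht =>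
      (htrap t ht).2.2.1.le
    have hroot := ((hE.const_mul (1 / 3)).sub hcurv).sqrt
    rw [sub_zero, one_div_mul_eq_div] at hroot
    refine hroot.congr' ?_
    filter_upwards [eventually_ge_atTop 0] with t ht
    have hfried : H t ^ 2 = 1 / 3 * energy V (φ t) (y t) (ρ t) - k / a t ^ 2 :=
      eq_sub_of_add_eq (h.friedmann t ht)
    rw [← hfried, Real.sqrt_sq (htrap t ht).2.2.1.le]

end Trapped

end Convergence

section Neighborhoods

variable {V : ℝ → ℝ} {k ℓ M : ℝ}

/-- The basic neighbourhoods of the configuration at infinity. -/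
def boxAtInfinity (ℓ M δ : ℝ) : Set (ℝ × ℝ × ℝ × ℝ) :=
  {p | M < p.1 ∧ |p.2.1| < δ ∧ |p.2.2.1| < δ ∧ |p.2.2.2 - √(ℓ / 3)| < δ}

theorem hasBasis_nhdsAtInfinity (ℓ : ℝ) : (nhdsAtInfinity ℓ).HasBasis
    (fun b : ℝ × ℝ => 0 < b.2) fun b => boxAtInfinity ℓ b.1 b.2 := by
  have hbasis := (atTop_basis_Ioi (α := ℝ)).prod ((Metric.nhds_basis_ball (x := (0 : ℝ))).prod
    ((Metric.nhds_basis_ball (x := (0 : ℝ))).prod (Metric.nhds_basis_ball (x := √(ℓ / 3)))))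
  refine hbasis.to_hasBasis ?_ ?_
  · rintro ⟨M, δ₁, δ₂, δ₃⟩ ⟨-, h₁, h₂, h₃⟩
    refine ⟨(M, min δ₁ (min δ₂ δ₃)), lt_min h₁ (lt_min h₂ h₃), ?_⟩
    rintro p ⟨hφ, hy, hρ, hH⟩
    simp only [lt_min_iff] at hy hρ hH
    refine ⟨hφ, ?_, ?_, ?_⟩ <;>
      simp only [Metric.mem_ball, Real.dist_eq, sub_zero, hy, hρ, hH]
  · rintro ⟨M, δ⟩ hδ
    refine ⟨(M, δ, δ, δ), ⟨trivial, hδ, hδ, hδ⟩, ?_⟩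
    rintro p ⟨hφ, hy, hρ, hH⟩
    simp only [Metric.mem_ball, Real.dist_eq, sub_zero] at hy hρ hH
    exact ⟨hφ, hy, hρ, hH⟩

theorem mem_boxAtInfinity_of_energy_lt {p : ℝ × ℝ × ℝ × ℝ} {δ : ℝ} (hδ : 0 ≤ δ) (hφ : M < p.1)
    (hρ : 0 ≤ p.2.2.1) (hV : ℓ ≤ V p.1) (hE : energy V p.1 p.2.1 p.2.2.1 < ℓ + min δ (δ ^ 2 / 2))
    (hH : |p.2.2.2 - √(ℓ / 3)| < δ) : p ∈ boxAtInfinity ℓ M δ := by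
  have hmin₁ := min_le_left δ (δ ^ 2 / 2)
  have hmin₂ := min_le_right δ (δ ^ 2 / 2)
  have hy2 := sq_velocity_le_energy_sub_potential (V := V) (φ := p.1) (y := p.2.1) hρ
  have hρE := density_le_energy_sub_potential (V := V) (φ := p.1) (y := p.2.1) (ρ := p.2.2.1)
  refine ⟨hφ, abs_lt_of_sq_lt_sq (by linarith) hδ, ?_, hH⟩
  rw [abs_of_nonneg hρ]
  linarith

theorem tendsto_energy_nhdsAtInfinity (hlim : Tendsto V atTop (𝓝 ℓ)) :
    Tendsto (fun p : ℝ × ℝ × ℝ × ℝ => energy V p.1 p.2.1 p.2.2.1) (nhdsAtInfinity ℓ) (𝓝 ℓ) := by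
  have hφ : Tendsto (fun p : ℝ × ℝ × ℝ × ℝ => p.1) (nhdsAtInfinity ℓ) atTop := tendsto_fst
  have hy : Tendsto (fun p : ℝ × ℝ × ℝ × ℝ => p.2.1) (nhdsAtInfinity ℓ) (𝓝 0) :=
    tendsto_fst.comp tendsto_snd
  have hρ : Tendsto (fun p : ℝ × ℝ × ℝ × ℝ => p.2.2.1) (nhdsAtInfinity ℓ) (𝓝 0) :=
    tendsto_fst.comp (tendsto_snd.comp tendsto_snd)
  have hE := (hρ.add ((hy.pow 2).const_mul (1 / 2))).add (hlim.comp hφ)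
  rwa [zero_pow two_ne_zero, mul_zero, zero_add, zero_add] at hE

theorem eventually_mem_trappingRegion (hlim : Tendsto V atTop (𝓝 ℓ)) (hM : ℓ < V M) :
    ∀ᶠ p in nhdsAtInfinity ℓ ⊓ 𝓟 (expandingStates V k), p ∈ trappingRegion V M := by
  have hφ : Tendsto (fun p : ℝ × ℝ × ℝ × ℝ => p.1) (nhdsAtInfinity ℓ) atTop := tendsto_fst
  rw [eventually_inf_principal]
  filter_upwards [hφ.eventually_gt_atTop M,
    (tendsto_energy_nhdsAtInfinity hlim).eventually (gt_mem_nhds hM)] with p hMφ hE hp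
  exact ⟨hMφ, hp.1, hp.2.1, hE⟩

end Neighborhoods

section Stability

variable {V : ℝ → ℝ} {γ k ℓ M : ℝ}

theorem existsGlobally_of_mem_trappingRegion (hV : ContDiff ℝ 2 V) (hγ : 0 ≤ γ) (hk : k ≤ 0)
    (hVpos : ∀ x, M ≤ x → 0 < V x) {p : ℝ × ℝ × ℝ × ℝ} (hp : p ∈ expandingStates V k)
    (hpM : p ∈ trappingRegion V M) : ExistsGlobally V γ k p := by
  have hVdiff := hV.differentiable two_ne_zero
  obtain ⟨-, -, a₀, ha₀, hconstraint⟩ := hp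
  refine (existsGlobally_or_unbounded hV γ ha₀ hconstraint).resolve_right fun hunbounded => ?_
  obtain ⟨S, hS, a, φ, y, ρ, H, h, rfl, hlarge⟩ := hunbounded (V M + 1 + p.2.2.2)
  refine hlarge ?_
  have h0 : (0 : ℝ) ∈ Set.Icc 0 S := Set.left_mem_Icc.2 hS
  have hSS : S ∈ Set.Icc 0 S := Set.right_mem_Icc.2 hS
  obtain ⟨hφ, hρ, hH, hE⟩ :=
    h.mem_trappingRegion hVdiff hγ hk hVpos hpM (convex_Icc 0 S) h0 hSS hS
  have hanti : H S ≤ H 0 := h.hubble_antitoneOn (convex_Icc 0 S) h0 hpM.2.1 hγ hk h0 hSS hS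
  have hVφ := hVpos _ hφ.le
  have hy2 := sq_velocity_le_energy_sub_potential (V := V) (φ := φ S) (y := y S) hρ
  have hρE := density_le_energy_sub_potential (V := V) (φ := φ S) (y := y S) (ρ := ρ S)
  simp only at hρ hH hE hVφ hy2 ⊢
  have hVM : 0 < V M := hVpos M le_rfl
  have hy : |y S| ≤ V M + 1 := abs_le_of_sq_le_sq (by linarith [sq_nonneg (V M)]) (by linarith)
  rw [abs_of_nonneg hρ, abs_of_pos hH]
  exact ⟨by linarith, by linarith, by linarith⟩

theorem isStableAtInfinity (hV : ContDiff ℝ 2 V) (hγ : 0 ≤ γ) (hk : k ≤ 0) (hℓ : 0 ≤ ℓ)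
    (hVℓ : Tendsto V atTop (𝓝[>] ℓ)) : IsStableAtInfinity V γ k ℓ := by
  intro U hU
  have hVdiff := hV.differentiable two_ne_zero
  have hlim := tendsto_nhds_of_tendsto_nhdsWithin hVℓ
  obtain ⟨M₀, hM₀⟩ := eventually_atTop.1 (hVℓ.eventually self_mem_nhdsWithin)
  obtain ⟨⟨M₁, δ⟩, hδ, hbox⟩ := (hasBasis_nhdsAtInfinity ℓ).mem_iff.1 hU
  set M := max M₀ M₁
  have hVM : ∀ x, M ≤ x → ℓ < V x := fun x hx => hM₀ x ((le_max_left _ _).trans hx)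
  have hVpos : ∀ x, M ≤ x → 0 < V x := fun x hx => hℓ.trans_lt (hVM x hx)
  have hη : ℓ < ℓ + min δ (δ ^ 2 / 2) := lt_add_of_pos_right ℓ (lt_min hδ (by positivity))
  filter_upwards [eventually_mem_trappingRegion hlim (hVM M le_rfl),
    ((tendsto_energy_nhdsAtInfinity hlim).eventually (gt_mem_nhds hη)).filter_mono inf_le_left,
    mem_inf_of_left ((hasBasis_nhdsAtInfinity ℓ).mem_of_mem (i := (M, δ)) hδ),
    mem_inf_of_right (mem_principal_self _)] with p hpM hpE hpbox hp
  refine ⟨existsGlobally_of_mem_trappingRegion hV hγ hk hVpos hp hpM, ?_⟩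
  rintro a φ y ρ H h rfl t ht
  have htrap : ∀ t, 0 ≤ t → (φ t, y t, ρ t, H t) ∈ trappingRegion V M := fun t ht =>
    h.mem_trappingRegion hVdiff hγ hk hVpos hpM (convex_Ici 0) Set.self_mem_Ici ht ht
  obtain ⟨hφ, hρ, hH, -⟩ := htrap t ht
  have hE : energy V (φ t) (y t) (ρ t) ≤ energy V (φ 0) (y 0) (ρ 0) :=
    h.energy_antitoneOn (convex_Ici 0) Set.self_mem_Ici hpM.2.1 hVdiff hγ
      (fun r hr => (htrap r hr).2.2.1.le) Set.self_mem_Ici ht ht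
  have hH₀ : H t ≤ H 0 := h.hubble_antitoneOn (convex_Ici 0) Set.self_mem_Ici hpM.2.1 hγ hk
    Set.self_mem_Ici ht ht
  have hHℓ := h.sqrt_le_hubble hk ht hH.le ((hVM _ hφ.le).le.trans (potential_le_energy hρ))
  have hmem := mem_boxAtInfinity_of_energy_lt hδ.le hφ hρ (hVM _ hφ.le).le (hE.trans_lt hpE) <| by
    rw [abs_of_nonneg (sub_nonneg.2 hHℓ)]
    exact (sub_le_sub_right hH₀ _).trans_lt ((le_abs_self _).trans_lt hpbox.2.2.2)
  exact hbox ⟨(le_max_right M₀ M₁).trans_lt hφ, hmem.2⟩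

theorem isAttractiveAtInfinity (hV : ContDiff ℝ 2 V) (hcrit : ∀ᶠ x in atTop, deriv V x ≠ 0)
    (hγ : 0 < γ) (hk : k ≤ 0) (hℓ : 0 ≤ ℓ) (hVℓ : Tendsto V atTop (𝓝[>] ℓ)) :
    IsAttractiveAtInfinity V γ k ℓ := by
  have hVdiff := hV.differentiable two_ne_zero
  have hlim := tendsto_nhds_of_tendsto_nhdsWithin hVℓ
  obtain ⟨M, hM⟩ := eventually_atTop.1 ((hVℓ.eventually self_mem_nhdsWithin).and
    (eventually_deriv_neg_of_tendsto_nhdsGT hVdiff hcrit hVℓ))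
  have hVM : ∀ x, M ≤ x → ℓ < V x := fun x hx => (hM x hx).1
  have hVpos : ∀ x, M ≤ x → 0 < V x := fun x hx => hℓ.trans_lt (hVM x hx)
  filter_upwards [eventually_mem_trappingRegion hlim (hVM M le_rfl),
    mem_inf_of_right (mem_principal_self _)] with p hpM hp
  refine ⟨existsGlobally_of_mem_trappingRegion hV hγ.le hk hVpos hp hpM, ?_⟩
  rintro a φ y ρ H h rfl
  exact h.convergesToInfinity hlim hγ hk hℓ hVM (fun x hx => (hM x hx).2)
    (fun t ht => h.mem_trappingRegion hVdiff hγ.le hk hVpos hpM (convex_Ici 0) Set.self_mem_Ici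
      ht ht) (hV.of_le one_le_two)

theorem isAsymptoticallyStableAtInfinity (hV : ContDiff ℝ 2 V)
    (hcrit : ∀ᶠ x in atTop, deriv V x ≠ 0) (hγ : 0 < γ) (hk : k ≤ 0) (hℓ : 0 ≤ ℓ)
    (hVℓ : Tendsto V atTop (𝓝[>] ℓ)) : IsAsymptoticallyStableAtInfinity V γ k ℓ :=
  ⟨isStableAtInfinity hV hγ.le hk hℓ hVℓ, isAttractiveAtInfinity hV hcrit hγ hk hℓ hVℓ⟩

end Stability

section Instability

variable {V : ℝ → ℝ} {γ k ℓ : ℝ} {a φ y ρ H : ℝ → ℝ}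

theorem IsCosmology.not_convergesToInfinity (h : IsCosmology V γ k (Set.Ici 0) a φ y ρ H)
    (hV : Differentiable ℝ V) (hlim : Tendsto V atTop (𝓝 ℓ)) (hγ : 0 ≤ γ) (hk : k ≤ 0)
    (hρ : 0 ≤ ρ 0) (hE : energy V (φ 0) (y 0) (ρ 0) < ℓ) : ¬ ConvergesToInfinity ℓ φ y ρ H := by
  rintro ⟨hφ, hy, hρlim, hHlim⟩
  have hH : ∀ t ∈ Set.Ici (0 : ℝ), 0 ≤ H t := fun t ht =>
    (Real.sqrt_nonneg (ℓ / 3)).trans <| le_of_tendsto hHlim <|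
      (eventually_ge_atTop t).mono fun r hr =>
        h.hubble_antitoneOn (convex_Ici 0) Set.self_mem_Ici hρ hγ hk ht (ht.trans hr) hr
  have hElim := (tendsto_energy_nhdsAtInfinity hlim).comp
    (hφ.prodMk (hy.prodMk (hρlim.prodMk hHlim)))
  refine hE.not_ge (le_of_tendsto hElim ((eventually_ge_atTop 0).mono fun t ht => ?_))
  exact h.energy_antitoneOn (convex_Ici 0) Set.self_mem_Ici hρ hV hγ hH Set.self_mem_Ici ht ht

theorem IsCosmology.exists_field_le_or_hubble_lt {M h₀ : ℝ}
    (h : IsCosmology V γ k (Set.Ici 0) a φ y ρ H) (hV : ContDiff ℝ 1 V) (hγ : 0 < γ) (hk : k ≤ 0)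
    (hVM : ∀ x, M ≤ x → 0 ≤ V x) (hV' : ∀ x, M ≤ x → 0 < deriv V x) (hφ : M ≤ φ 0) (hy : y 0 = 0)
    (hρ : ρ 0 = 0) (hh₀ : 0 < h₀) : ∃ t, 0 ≤ t ∧ (φ t ≤ M ∨ H t < h₀) := by
  by_contra! hstay
  have hVdiff := hV.differentiable one_ne_zero
  have hmono := strictMonoOn_of_deriv_pos (convex_Ici M) hVdiff.continuous.continuousOn
    fun x hx => hV' x (interior_subset hx)
  -- The energy never exceeds its initial value `V (φ 0)`, so `φ` cannot climb above `φ 0`.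
  have hφ_le : ∀ t, 0 ≤ t → φ t ≤ φ 0 := by
    intro t ht
    have hE := h.energy_antitoneOn (convex_Ici 0) Set.self_mem_Ici hρ.ge hVdiff hγ.le
      (fun r hr => hh₀.le.trans (hstay r hr).2) Set.self_mem_Ici ht ht
    have hVE := potential_le_energy (V := V) (φ := φ t) (y := y t)
      (h.density_nonneg (convex_Ici 0) Set.self_mem_Ici hρ.ge ht)
    refine (hmono.le_iff_le (hstay t ht).1.le hφ).1 (hVE.trans (hE.trans_eq ?_))
    simp only [energy, hy, hρ, zero_pow two_ne_zero, mul_zero, zero_add]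
  obtain ⟨c, hc, hforce⟩ := (isCompact_Icc (a := M) (b := φ 0)).exists_forall_le'
    hV.continuous_deriv_one.continuousOn fun x hx => hV' x hx.1
  obtain ⟨t, ht, hlt⟩ := h.exists_force_add_dissipation_lt hVdiff hγ hk hρ.ge
    (fun t ht => hVM _ (hstay t ht).1.le) hh₀ (fun t ht => (hstay t ht).2)
    (σ := 1) (B := 0) abs_one.le le_rfl hc
  linarith [hforce (φ t) ⟨(hstay t ht).1.le, hφ_le t ht⟩]

theorem existsGlobally_or_leaves_boxAtInfinity (hV : ContDiff ℝ 2 V) (γ : ℝ) {M δ : ℝ}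
    {p : ℝ × ℝ × ℝ × ℝ} (hp : p ∈ expandingStates V k) (hpbox : p ∈ boxAtInfinity ℓ M δ) :
    ExistsGlobally V γ k p ∨ ∃ T, 0 < T ∧ ∃ a φ y ρ H : ℝ → ℝ,
      IsCosmology V γ k (Set.Icc 0 T) a φ y ρ H ∧ StartsAt p φ y ρ H ∧
      (φ T, y T, ρ T, H T) ∉ boxAtInfinity ℓ M δ := by
  obtain ⟨-, -, a₀, ha₀, hconstraint⟩ := hp
  refine (existsGlobally_or_unbounded hV γ ha₀ hconstraint).imp_right fun hunbounded => ?_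
  obtain ⟨T, hT, a, φ, y, ρ, H, h, hstart, hlarge⟩ := hunbounded (√(ℓ / 3) + δ)
  have hout : (φ T, y T, ρ T, H T) ∉ boxAtInfinity ℓ M δ := by
    rintro ⟨-, hy, hρ, hH⟩
    simp only at hy hρ hH
    have hroot := Real.sqrt_nonneg (ℓ / 3)
    refine hlarge ⟨by linarith, by linarith, ?_⟩
    linarith [abs_sub_abs_le_abs_sub (H T) √(ℓ / 3), abs_of_nonneg hroot]
  refine ⟨T, hT.lt_of_ne ?_, a, φ, y, ρ, H, h, hstart, hout⟩
  rintro rfl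
  exact hout (hstart ▸ hpbox)

theorem exists_leaves_boxAtInfinity {M δ : ℝ} (hV : ContDiff ℝ 2 V) (hγ : 0 < γ) (hk : k ≤ 0)
    (hVM : ∀ x, M ≤ x → 0 ≤ V x) (hV' : ∀ x, M ≤ x → 0 < deriv V x) (hδ : δ < √(ℓ / 3))
    {p : ℝ × ℝ × ℝ × ℝ} (hp : p ∈ expandingStates V k) (hpbox : p ∈ boxAtInfinity ℓ M δ)
    (hy : p.2.1 = 0) (hρ : p.2.2.1 = 0) :
    ∃ T, 0 < T ∧ ∃ a φ y ρ H : ℝ → ℝ, IsCosmology V γ k (Set.Icc 0 T) a φ y ρ H ∧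
      StartsAt p φ y ρ H ∧ (φ T, y T, ρ T, H T) ∉ boxAtInfinity ℓ M δ := by
  refine (existsGlobally_or_leaves_boxAtInfinity hV γ hp hpbox).elim ?_ id
  rintro ⟨a, φ, y, ρ, H, h, rfl⟩
  obtain ⟨T, hT, hout⟩ := h.exists_field_le_or_hubble_lt (hV.of_le one_le_two) hγ hk hVM hV'
    hpbox.1.le hy hρ (sub_pos.2 hδ)
  have hleaves : (φ T, y T, ρ T, H T) ∉ boxAtInfinity ℓ M δ := by
    rintro ⟨hφ, -, -, hH⟩
    simp only at hφ hH
    exact hout.elim hφ.not_ge fun hlt => by linarith [(abs_lt.1 hH).1]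
  refine ⟨T, hT.lt_of_ne ?_, a, φ, y, ρ, H, h.mono Set.Icc_subset_Ici_self, rfl, hleaves⟩
  rintro rfl
  exact hleaves hpbox

/-- The scalar field at rest at the value `x`, without fluid, in a universe of scale factor
`a = √(3 / (ℓ - V x))`; with this choice `k / a ^ 2 → 0` as `V x → ℓ`, which makes the state
approach the configuration at infinity for every curvature. -/
noncomputable def restState (V : ℝ → ℝ) (k ℓ x : ℝ) : ℝ × ℝ × ℝ × ℝ :=
  (x, 0, 0, √((V x - k * (ℓ - V x)) / 3))

theorem tendsto_restState (hlim : Tendsto V atTop (𝓝 ℓ)) (k : ℝ) :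
    Tendsto (restState V k ℓ) atTop (nhdsAtInfinity ℓ) := by
  refine tendsto_id.prodMk (tendsto_const_nhds.prodMk (tendsto_const_nhds.prodMk ?_))
  have hroot := ((hlim.sub ((hlim.const_sub ℓ).const_mul k)).div_const 3).sqrt
  rwa [sub_self, mul_zero, sub_zero] at hroot

theorem restState_mem_expandingStates (hk : k ≤ 0) {x : ℝ} (hx : 0 < V x) (hxℓ : V x < ℓ) :
    restState V k ℓ x ∈ expandingStates V k := by
  have hgap : 0 < (ℓ - V x) / 3 := by linarith
  have hH : 0 < (V x - k * (ℓ - V x)) / 3 := by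
    linarith [mul_nonneg (neg_nonneg.2 hk) (sub_pos.2 hxℓ).le]
  refine ⟨le_rfl, Real.sqrt_pos.2 hH, (√((ℓ - V x) / 3))⁻¹, by positivity, ?_⟩
  simp only [restState]
  rw [Real.sq_sqrt hH.le, inv_pow, Real.sq_sqrt hgap.le, div_inv_eq_mul]
  ring

theorem isUnstableAtInfinity (hV : ContDiff ℝ 2 V) (hcrit : ∀ᶠ x in atTop, deriv V x ≠ 0)
    (hγ : 0 < γ) (hk : k ≤ 0) (hℓ : 0 < ℓ) (hVℓ : Tendsto V atTop (𝓝[<] ℓ)) :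
    IsUnstableAtInfinity V γ k ℓ := by
  have hVdiff := hV.differentiable two_ne_zero
  have hlim := tendsto_nhds_of_tendsto_nhdsWithin hVℓ
  obtain ⟨M, hM⟩ := eventually_atTop.1 ((hVℓ.eventually self_mem_nhdsWithin).and
    ((hlim.eventually (lt_mem_nhds hℓ)).and
      (eventually_deriv_pos_of_tendsto_nhdsLT hVdiff hcrit hVℓ)))
  have hδ : 0 < √(ℓ / 3) / 2 := by positivity
  have hbox : boxAtInfinity ℓ M (√(ℓ / 3) / 2) ∈ nhdsAtInfinity ℓ :=
    (hasBasis_nhdsAtInfinity ℓ).mem_of_mem (i := (M, √(ℓ / 3) / 2)) hδ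
  have hrest : ∀ᶠ x in atTop, restState V k ℓ x ∈ expandingStates V k :=
    (eventually_ge_atTop M).mono fun x hx =>
      restState_mem_expandingStates hk (hM x hx).2.1 (hM x hx).1
  refine ⟨_, hbox, Tendsto.frequently (tendsto_inf.2
    ⟨tendsto_restState hlim k, tendsto_principal.2 hrest⟩) (Eventually.frequently ?_)⟩
  filter_upwards [hrest, (tendsto_restState hlim k).eventually hbox, eventually_ge_atTop M]
    with x hx hxbox hMx
  refine ⟨exists_leaves_boxAtInfinity hV hγ hk (fun z hz => (hM z hz).2.1.le)
    (fun z hz => (hM z hz).2.2) (half_lt_self (by positivity)) hx hxbox rfl rfl,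
    fun a φ y ρ H h hstart => ?_⟩
  simp only [StartsAt, restState, Prod.mk.injEq] at hstart
  obtain ⟨hφ, hy, hρ, -⟩ := hstart
  refine h.not_convergesToInfinity hVdiff hlim hγ.le hk hρ.ge ?_
  simp only [energy, hφ, hy, hρ, zero_pow two_ne_zero, mul_zero, zero_add]
  exact (hM x hMx).1

end Instability

theorem mainTheorem3_general (γ : ℝ) (hγ : 0 < γ) (k : ℝ) (hk : k ≤ 0) :
    (∀ (V : ℝ → ℝ) (ℓ : ℝ), ContDiff ℝ 2 V → (∀ᶠ x in atTop, deriv V x ≠ 0) → 0 ≤ ℓ →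
      Tendsto V atTop (𝓝[>] ℓ) → IsAsymptoticallyStableAtInfinity V γ k ℓ) ∧
    (∀ V₀ lam : ℝ, 0 < V₀ → 0 < lam →
      IsAsymptoticallyStableAtInfinity (fun x => V₀ * Real.exp (-lam * x)) γ k 0) ∧
    (∀ (V : ℝ → ℝ) (ℓ : ℝ), ContDiff ℝ 2 V → (∀ᶠ x in atTop, deriv V x ≠ 0) → 0 < ℓ →
      Tendsto V atTop (𝓝[<] ℓ) → IsUnstableAtInfinity V γ k ℓ) :=
  ⟨fun _ _ hV hcrit hℓ hVℓ => isAsymptoticallyStableAtInfinity hV hcrit hγ hk hℓ hVℓ,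
    fun V₀ lam hV₀ hlam => isAsymptoticallyStableAtInfinity (contDiff_exponential V₀ lam)
      (Eventually.of_forall (deriv_exponential_ne_zero hV₀.ne' hlam.ne')) hγ hk le_rfl
      (tendsto_exponential_nhdsGT hV₀ hlam),
    fun _ _ hV hcrit hℓ hVℓ => isUnstableAtInfinity hV hcrit hγ hk hℓ hVℓ⟩

theorem mainTheorem3 (γ : ℝ) (hγ₀ : 0 < γ) (hγ₂ : γ ≤ 2) (k : ℝ) (hk : k = 0 ∨ k = -1) :
    (∀ (V : ℝ → ℝ) (ℓ : ℝ), IsAdmissiblePotential V → 0 ≤ ℓ → Tendsto V atTop (𝓝[>] ℓ) →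
      IsAsymptoticallyStableAtInfinity V γ k ℓ) ∧
    (∀ V₀ lam : ℝ, 0 < V₀ → 0 < lam →
      IsAsymptoticallyStableAtInfinity (fun x => V₀ * Real.exp (-lam * x)) γ k 0) ∧
    (∀ (V : ℝ → ℝ) (ℓ : ℝ), IsAdmissiblePotential V → 0 ≤ ℓ → Tendsto V atTop (𝓝[<] ℓ) →
      IsUnstableAtInfinity V γ k ℓ) := by
  have hk₀ : k ≤ 0 := by rcases hk with rfl | rfl <;> norm_num
  obtain ⟨hstable, hexponential, hunstable⟩ := mainTheorem3_general γ hγ₀ k hk₀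
  exact ⟨fun V ℓ hV hℓ hVℓ => hstable V ℓ hV.contDiff hV.eventually_deriv_ne_zero hℓ hVℓ,
    hexponential,
    fun V ℓ hV _ hVℓ =>
      hunstable V ℓ hV.contDiff hV.eventually_deriv_ne_zero (hV.limit_pos hVℓ) hVℓ⟩
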